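/- Let $I$ be a finite set and let $\Delta$ be a right-angled building of type $M=(m_{ij})_{i,j\in I}$ (that is, $m_{ij}\in\{2,\infty\}$ for all $i\neq j$), viewed as a chamber system. For each $i\in I$ let $X_i$ be a set and let $F_i\leq\operatorname{Sym}(X_i)$ be a permutation group (not necessarily transitive or of finite degree). Assume that $\Delta$ is semiregular with parameters $q_i=|X_i|\geq 2$, i.e. every $i$-panel has cardinality $q_i$, and fix a legal colouring $\lambda=(\lambda_i)_{i\in I}\colon\Delta\to\prod_{i\in I}X_i$: for every $i\in I$ and every $i$-panel $\mathcal P$, the restriction $\lambda_i|_{\mathcal P}\colon\mathcal P\to X_i$ is a bijection, and $\lambda_j|_{\mathcal P}$ is constant for every $j\neq i$. Let $\operatorname{Aut}(\Delta)$ be the group of type-preserving automorphisms of $\Delta$, and let $$U(\boldsymbol F)=\bigl\{g\in\operatorname{Aut}(\Delta) : \lambda_i|_{g\mathcal P}\circ g|_{\mathcal P}\circ(\lambda_i|_{\mathcal P})^{-1}\in F_i\text{ for every } i\in I \text{ and every } i\text{-panel } \mathcal P\bigr\}$$ be the universal group with local groups $\boldsymbol F=(F_i)_{i\in I}$. Every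 permutation group $G\leq\operatorname{Sym}(Y)$ (in particular $F_i\leq\operatorname{Sym}(X_i)$ and $U(\boldsymbol F)\leq\operatorname{Aut}(\Delta)\leq\operatorname{Sym}(\Delta)$) carries the permutation topology, in which the pointwise stabilisers of finite subsets of $Y$ form a neighbourhood basis of the identity. A topological group is called compactly generated if it is generated, as a group, by a compact subset. Suppose that $U(\boldsymbol F)$ is closed in $\operatorname{Aut}(\Delta)$ and locally compact, and that for each $i\in I$ the group $F_i$ is compactly generated and has finitely many orbits on $X_i$. Then $U(\boldsymbol F)$ is compactly generated. -/

import Mathlib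

/-! ### Permutation groups as topological groups -/

/-- The permutation topology on `Sym(X)`: a set `U` is open iff around each of its points `g` it
contains a coset `g · Sym(X)_{(Φ)}` of the pointwise stabiliser of a finite set `Φ ⊆ X`. Permutation
groups `G ≤ Sym(X)` carry the subspace topology. -/
instance permTopology (X : Type*) : TopologicalSpace (Equiv.Perm X) where
  IsOpen U := ∀ g ∈ U, ∃ Φ : Finset X,
    ∀ s ∈ fixingSubgroup (Equiv.Perm X) (Φ : Set X), g * s ∈ U
  isOpen_univ := fun _ _ => ⟨∅, fun _ _ => trivial⟩
  isOpen_inter := by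
    classical
    intro U V hU hV g hg
    obtain ⟨Φ, hΦ⟩ := hU g hg.1
    obtain ⟨Ψ, hΨ⟩ := hV g hg.2
    refine ⟨Φ ∪ Ψ, fun s hs => ⟨hΦ s ?_, hΨ s ?_⟩⟩
    · exact fixingSubgroup_antitone _ _ (by simp) hs
    · exact fixingSubgroup_antitone _ _ (by simp) hs
  isOpen_sUnion := by
    intro S hS g hg
    obtain ⟨U, hU, hgU⟩ := hg
    obtain ⟨Φ, hΦ⟩ := hS U hU g hgU
    exact ⟨Φ, fun s hs => ⟨U, hU, hΦ s hs⟩⟩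

/-- A topological group is compactly generated if some compact subset generates it
(algebraically) as a group. -/
def IsCompactlyGeneratedGroup (G : Type*) [Group G] [TopologicalSpace G] : Prop :=
  ∃ S : Set G, IsCompact S ∧ Subgroup.closure S = ⊤

/-! ### Chamber systems and right-angled buildings -/

/-- A chamber system over the index set `I` with set of chambers `Δ`: an equivalence relation on
`Δ` (`i`-adjacency) for each `i ∈ I`. -/
structure ChamberSystem (I : Type*) (Δ : Type*) where
  adj : I → Setoid Δ

namespace ChamberSystem

variable {I Δ : Type*}

/-- The `i`-panels (that is, the residues of type `{i}`): the classes of `i`-adjacency. -/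
def panels (C : ChamberSystem I Δ) (i : I) : Set (Set Δ) := (C.adj i).classes

/-- `C.IsGallery c ω d`: there is a gallery of type `ω` from `c` to `d`. Consecutive chambers of a
gallery are distinct. -/
inductive IsGallery (C : ChamberSystem I Δ) : Δ → List I → Δ → Prop
  | nil (c : Δ) : IsGallery C c [] c
  | cons {c d e : Δ} {i : I} {ω : List I} :
      (C.adj i) c d → c ≠ d → IsGallery C d ω e → IsGallery C c (i :: ω) e

/-- A chamber system is a building of type `M` if it has a chamber, each panel contains at least
two chambers, and there is a Weyl distance `δ : Δ × Δ → W` to the Coxeter group `W` of type `M`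
such that, for every reduced word `ω`, `δ(c, d)` is the element represented by `ω` iff `c` and `d`
are joined by a gallery of type `ω`. -/
structure IsBuilding (C : ChamberSystem I Δ) (M : CoxeterMatrix I) : Prop where
  nonempty : Nonempty Δ
  panel_nontrivial : ∀ i, ∀ P ∈ C.panels i, P.Nontrivial
  exists_dist : ∃ δ : Δ → Δ → M.Group, ∀ ω : List I, M.toCoxeterSystem.IsReduced ω →
    ∀ c d : Δ, δ c d = M.toCoxeterSystem.wordProd ω ↔ C.IsGallery c ω d

/-- The group `Aut(Δ)` of (type-preserving) automorphisms: the permutations of the chambers that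
preserve `i`-adjacency for each `i`. -/
def aut (C : ChamberSystem I Δ) : Subgroup (Equiv.Perm Δ) where
  carrier := {g | ∀ i c d, (C.adj i) (g c) (g d) ↔ (C.adj i) c d}
  one_mem' := fun _ _ _ => Iff.rfl
  mul_mem' := fun {g h} hg hh i c d => (hg i (h c) (h d)).trans (hh i c d)
  inv_mem' := fun {g} hg i c d => by
    simpa using (hg i (g⁻¹ c) (g⁻¹ d)).symm

/-- An automorphism maps `i`-panels to `i`-panels. -/
theorem image_mem_panels (C : ChamberSystem I Δ) (g : C.aut) {i : I} {P : Set Δ}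
    (hP : P ∈ C.panels i) : (g : Equiv.Perm Δ) '' P ∈ C.panels i := by
  obtain ⟨c, rfl⟩ := hP
  refine ⟨(g : Equiv.Perm Δ) c, ?_⟩
  ext d
  constructor
  · rintro ⟨e, he, rfl⟩
    exact (g.2 i e c).2 he
  · intro hd
    refine ⟨(g : Equiv.Perm Δ).symm d, ?_, by simp⟩
    refine (g.2 i _ c).1 ?_
    simpa using hd

end ChamberSystem

/-- A Coxeter matrix is right-angled if `m_{ij} ∈ {2, ∞}` for all distinct `i`, `j`
(Mathlib encodes `m_{ij} = ∞` as `M i j = 0`). -/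
def CoxeterMatrix.IsRightAngled {I : Type*} (M : CoxeterMatrix I) : Prop :=
  ∀ i j, i ≠ j → M i j = 2 ∨ M i j = 0

/-! ### Legal colourings, local actions and universal groups -/

/-- A legal colouring `λ` of a chamber system with colour sets `X i`: on each `i`-panel the
`i`-colour is a bijection to `X i` and each other colour is constant. -/
structure LegalColouring {I Δ : Type*} (C : ChamberSystem I Δ) (X : I → Type*) where
  colour : Δ → ∀ i, X i
  bijective : ∀ i, ∀ P ∈ C.panels i, Function.Bijective fun c : P => colour c i
  constant : ∀ i, ∀ P ∈ C.panels i, ∀ j, j ≠ i → ∀ c ∈ P, ∀ d ∈ P, colour c j = colour d j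

namespace LegalColouring

variable {I Δ : Type*} {C : ChamberSystem I Δ} {X : I → Type*}

/-- The bijection `λ_i|_P : P → X i` for an `i`-panel `P`. -/
noncomputable def panelEquiv (l : LegalColouring C X) {i : I} {P : Set Δ} (hP : P ∈ C.panels i) :
    P ≃ X i :=
  Equiv.ofBijective (fun c : P => l.colour c i) (l.bijective i P hP)

/-- The local action `σ(g, P) = λ_i|_{gP} ∘ g|_P ∘ (λ_i|_P)⁻¹ ∈ Sym(X i)` of an automorphism `g`
at an `i`-panel `P`. -/
noncomputable def localAction (l : LegalColouring C X) (g : C.aut) {i : I} {P : Set Δ}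
    (hP : P ∈ C.panels i) : Equiv.Perm (X i) :=
  (l.panelEquiv hP).symm.trans
    (((g : Equiv.Perm Δ).image P).trans (l.panelEquiv (C.image_mem_panels g hP)))

theorem localAction_colour (l : LegalColouring C X) (g : C.aut) {i : I} {P : Set Δ}
    (hP : P ∈ C.panels i) {c : Δ} (hc : c ∈ P) :
    l.localAction g hP (l.colour c i) = l.colour ((g : Equiv.Perm Δ) c) i := by
  have h : (l.panelEquiv hP).symm (l.colour c i) = ⟨c, hc⟩ := by
    rw [Equiv.symm_apply_eq]; rfl
  simp only [localAction, Equiv.trans_apply, h]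
  rfl

theorem localAction_eq (l : LegalColouring C X) (g : C.aut) {i : I} {P : Set Δ}
    (hP : P ∈ C.panels i) {f : Equiv.Perm (X i)}
    (h : ∀ c ∈ P, f (l.colour c i) = l.colour ((g : Equiv.Perm Δ) c) i) :
    l.localAction g hP = f := by
  ext x
  obtain ⟨⟨c, hc⟩, rfl⟩ := (l.bijective i P hP).2 x
  exact (l.localAction_colour g hP hc).trans (h c hc).symm

/-- The universal group `U(F) ≤ Aut(Δ)` of the local groups `F i ≤ Sym(X i)`: the automorphisms all
of whose local actions at `i`-panels belong to `F i`. -/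
def universalGroup (l : LegalColouring C X) (F : ∀ i, Subgroup (Equiv.Perm (X i))) :
    Subgroup C.aut where
  carrier := {g | ∀ i, ∀ P : Set Δ, ∀ hP : P ∈ C.panels i, l.localAction g hP ∈ F i}
  one_mem' := fun i P hP => by
    rw [l.localAction_eq 1 hP (f := 1) (fun _ _ => rfl)]
    exact (F i).one_mem
  mul_mem' := fun {g h} hg hh i P hP => by
    rw [l.localAction_eq (g * h) hP
      (f := l.localAction g (C.image_mem_panels h hP) * l.localAction h hP) (fun c hc => by
        rw [Equiv.Perm.mul_apply, l.localAction_colour h hP hc,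
          l.localAction_colour g _ (Set.mem_image_of_mem _ hc)]
        rfl)]
    exact (F i).mul_mem (hg i _ _) (hh i _ _)
  inv_mem' := fun {g} hg i P hP => by
    rw [l.localAction_eq g⁻¹ hP (f := (l.localAction g (C.image_mem_panels g⁻¹ hP))⁻¹)
      (fun c hc => by
        rw [Equiv.Perm.inv_eq_iff_eq,
          l.localAction_colour g _ (Set.mem_image_of_mem _ hc)]
        simp)]
    exact (F i).inv_mem (hg i _ _)

end LegalColouring

/-! By local compactness, some finite set `Φ` of chambers has a compact pointwise stabiliser in
`U(F)`. It therefore suffices that `U(F)` is generated by the stabiliser of `Φ` together with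
finitely many elements (`finiteOver_top`).

The main tool is a homomorphism `L : F i → U(F)` attached to a chamber `c` and a type `i`
(`exists_wingHom`). The chambers are partitioned into wings according to their projection to the
`i`-panel of `c`. `L` permutes the wings as `F i` permutes the colours, and `L f` fixes pointwise
each wing whose colour `f` fixes. Since `Φ` meets finitely many wings and `F i` is compactly
generated, the image of `L` is finitely generated over the stabiliser of `Φ`.

If `g` fixes `c` and a set `Ψ` containing it, correcting `g` by some `L f` makes it fix a neighbour
of `c` as well, without losing `Ψ`. Moving along galleries, one reaches all of `Φ`, so chamber
stabilisers are finitely generated over the stabiliser of `Φ`. There are finitely many orbits of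
chambers, and connectedness of the building then gives all of `U(F)`.

Automorphisms are built from coloured words: a chamber is reached from a base chamber by prescribing
successive colours, and coincidences between endpoints survive a recolouring
(`walk_recolour_congr`). This and the theory of wings rest on a combinatorial solution of the word
problem (`isReduced_iff_traceReduced`). -/

/-! ### Reduced words in right-angled Coxeter groups -/

namespace CoxeterMatrix

variable {I : Type*} (M : CoxeterMatrix I)

/-- The letter `i` occurs in the word, preceded only by letters that commute with it. -/
def Exposed (i : I) : List I → Prop
  | [] => False
  | j :: ω => j = i ∨ (M i j = 2 ∧ Exposed i ω)

/-- No two occurrences of a letter can be brought together by exchanging commuting letters. -/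
def TraceReduced : List I → Prop
  | [] => True
  | i :: ω => ¬ M.Exposed i ω ∧ TraceReduced ω

variable {M}

theorem ne_of_eq_two {i j : I} (h : M i j = 2) : i ≠ j := by
  rintro rfl
  simp at h

theorem Exposed.mem {i : I} {ω : List I} (h : M.Exposed i ω) : i ∈ ω := by
  induction ω with
  | nil => exact h.elim
  | cons j ω ih =>
    rcases h with rfl | ⟨-, h⟩
    · exact List.mem_cons_self
    · exact List.mem_cons_of_mem _ (ih h)

theorem exposed_append_singleton {i k : I} {ω : List I} :
    M.Exposed i (ω ++ [k]) ↔ M.Exposed i ω ∨ (i = k ∧ ∀ j ∈ ω, M i j = 2) := by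
  induction ω with
  | nil => simp [Exposed, eq_comm]
  | cons j ω ih =>
    simp only [List.cons_append, Exposed, ih, List.forall_mem_cons]
    tauto

theorem TraceReduced.of_append {ω η : List I} (h : M.TraceReduced (ω ++ η)) :
    M.TraceReduced ω := by
  induction ω with
  | nil => trivial
  | cons i ω ih =>
    refine ⟨fun hi => h.1 ?_, ih h.2⟩
    clear h ih
    induction ω with
    | nil => exact hi.elim
    | cons j ω ih => exact hi.imp id fun h => ⟨h.1, ih h.2⟩

/-! ### The geometric representation over the integers -/

section Representation

variable [Fintype I]

variable (M) in
/-- The sum of the coordinates at the letters that do not commute with `i`. -/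
def linkSum (i : I) : (I → ℤ) →ₗ[ℤ] ℤ where
  toFun v := ∑ j, if M i j = 0 then v j else 0
  map_add' v w := by
    rw [← Finset.sum_add_distrib]
    exact Finset.sum_congr rfl fun j _ => by split_ifs <;> simp
  map_smul' a v := by
    simp [Finset.mul_sum]

theorem linkSum_apply (i : I) (v : I → ℤ) :
    M.linkSum i v = ∑ j, if M i j = 0 then v j else 0 := rfl

theorem linkSum_nonneg {v : I → ℤ} (hv : 0 ≤ v) (i : I) : 0 ≤ M.linkSum i v :=
  Finset.sum_nonneg fun j _ => by
    split_ifs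
    exacts [hv j, le_rfl]

theorem le_linkSum {v : I → ℤ} (hv : 0 ≤ v) {i j : I} (h : M i j = 0) :
    v j ≤ M.linkSum i v := by
  have := Finset.single_le_sum (f := fun j => if M i j = 0 then v j else 0)
    (fun k _ => by split_ifs; exacts [hv k, le_rfl]) (Finset.mem_univ j)
  simpa [h, linkSum_apply] using this

open Classical in
variable (M) in
/-- The reflection `s i` in the geometric representation of a right-angled Coxeter group. -/
noncomputable def geomReflection (i : I) : Module.End ℤ (I → ℤ) :=
  LinearMap.id + (2 • M.linkSum i - 2 • LinearMap.proj i).smulRight (Pi.single i 1)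

theorem geomReflection_apply_self (i : I) (v : I → ℤ) :
    M.geomReflection i v i = 2 * M.linkSum i v - v i := by
  simp [geomReflection]
  ring

theorem geomReflection_apply_of_ne {i k : I} (h : k ≠ i) (v : I → ℤ) :
    M.geomReflection i v k = v k := by
  simp [geomReflection, h]

theorem linkSum_geomReflection {i j : I} (h : M j i ≠ 0) (v : I → ℤ) :
    M.linkSum j (M.geomReflection i v) = M.linkSum j v := by
  rw [linkSum_apply, linkSum_apply]
  refine Finset.sum_congr rfl fun k _ => ?_
  split_ifs with hk
  · rw [geomReflection_apply_of_ne (by rintro rfl; exact h hk)]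
  · rfl

theorem geomReflection_geomReflection (i : I) (v : I → ℤ) :
    M.geomReflection i (M.geomReflection i v) = v := by
  ext k
  by_cases hk : k = i
  · subst hk
    rw [geomReflection_apply_self, linkSum_geomReflection (by simp), geomReflection_apply_self]
    ring
  · rw [geomReflection_apply_of_ne hk, geomReflection_apply_of_ne hk]

theorem geomReflection_comm {i j : I} (h : M i j = 2) (v : I → ℤ) :
    M.geomReflection i (M.geomReflection j v) = M.geomReflection j (M.geomReflection i v) := by
  have hij := ne_of_eq_two h
  have h' : M j i = 2 := M.symmetric j i ▸ h
  ext k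
  by_cases hi : k = i
  · subst hi
    rw [geomReflection_apply_self, linkSum_geomReflection (by simp [h]),
      geomReflection_apply_of_ne hij, geomReflection_apply_of_ne hij, geomReflection_apply_self]
  by_cases hj : k = j
  · subst hj
    rw [geomReflection_apply_of_ne hij.symm, geomReflection_apply_self, geomReflection_apply_self,
      linkSum_geomReflection (by simp [h']), geomReflection_apply_of_ne hij.symm]
  · simp only [geomReflection_apply_of_ne hi, geomReflection_apply_of_ne hj]

theorem isLiftable_geomReflection (hM : M.IsRightAngled) : M.IsLiftable M.geomReflection := by
  intro i j
  by_cases hij : i = j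
  · subst hij
    rw [M.diagonal, pow_one]
    exact LinearMap.ext fun v => geomReflection_geomReflection i v
  rcases hM i j hij with h | h
  · rw [h, pow_two]
    refine LinearMap.ext fun v => ?_
    simp only [Module.End.mul_apply, Module.End.one_apply]
    rw [geomReflection_comm h, geomReflection_geomReflection, geomReflection_geomReflection]
  · rw [h, pow_zero]

/-- The product of reflections along a trace-reduced word maps the last simple root to a
nonnegative vector; the second part says on which side of each wall it lies. -/
theorem geomReflection_prod_nonneg (hM : M.IsRightAngled) [DecidableEq I] (k : I) :
    ∀ ω : List I, M.TraceReduced (ω ++ [k]) →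
      0 ≤ (ω.map M.geomReflection).prod (Pi.single k 1) ∧
      ∀ i, (M.Exposed i (ω ++ [k]) →
          M.linkSum i ((ω.map M.geomReflection).prod (Pi.single k 1)) ≤
            (ω.map M.geomReflection).prod (Pi.single k 1) i) ∧
        (¬ M.Exposed i (ω ++ [k]) →
          (ω.map M.geomReflection).prod (Pi.single k 1) i ≤
            M.linkSum i ((ω.map M.geomReflection).prod (Pi.single k 1))) := by
  intro ω
  induction ω with
  | nil =>
    intro _
    have h0 : (0 : I → ℤ) ≤ Pi.single k 1 := Pi.single_nonneg.2 zero_le_one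
    refine ⟨by simp, fun i => ⟨fun hi => ?_, fun hi => ?_⟩⟩
    · have hi : k = i := by simpa [Exposed] using hi
      subst hi
      have : M.linkSum k (Pi.single k 1) = 0 := by
        rw [linkSum_apply]
        refine Finset.sum_eq_zero fun j _ => ?_
        split_ifs with h
        · rw [Pi.single_eq_of_ne]
          rintro rfl
          simp at h
        · rfl
      simp [this]
    · have hi : k ≠ i := by simpa [Exposed] using hi
      simpa [Pi.single_eq_of_ne hi.symm] using linkSum_nonneg h0 i
  | cons j ω ih =>
    rintro ⟨hj, hω⟩
    obtain ⟨h0, hS⟩ := ih hω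
    rw [List.map_cons, List.prod_cons, Module.End.mul_apply]
    set v := (ω.map M.geomReflection).prod (Pi.single k 1)
    have hjv := (hS j).2 hj
    have hge : M.linkSum j v ≤ M.geomReflection j v j := by
      rw [geomReflection_apply_self]; linarith
    have h0' : 0 ≤ M.geomReflection j v := by
      intro i
      by_cases hi : i = j
      · subst hi
        exact (linkSum_nonneg h0 i).trans hge
      · rw [geomReflection_apply_of_ne hi]
        exact h0 i
    refine ⟨h0', fun i => ?_⟩
    rw [List.cons_append]
    by_cases hi : i = j
    · subst hi
      refine ⟨fun _ => ?_, fun h => (h (Or.inl rfl)).elim⟩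
      rw [linkSum_geomReflection (by simp)]
      exact hge
    rcases hM i j hi with h | h
    · have : M.Exposed i (j :: (ω ++ [k])) ↔ M.Exposed i (ω ++ [k]) := by
        simp [Exposed, h, Ne.symm hi]
      rw [this, linkSum_geomReflection (by simp [h]), geomReflection_apply_of_ne hi]
      exact hS i
    · refine ⟨fun h' => ?_, fun _ => ?_⟩
      · rcases h' with h' | h'
        · exact (hi h'.symm).elim
        · omega
      · rw [geomReflection_apply_of_ne hi]
        -- As `i` and `j` are linked, coordinate `i` is at most the old link sum at `j`, hence at
        -- most the new coordinate `j`, which is one term of the new link sum at `i`.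
        exact (le_linkSum h0 (M.symmetric i j ▸ h)).trans (hge.trans (le_linkSum h0' h))

end Representation

end CoxeterMatrix

/-! ### The word problem for right-angled Coxeter groups -/

namespace CoxeterSystem

open CoxeterMatrix

variable {I : Type*} {M : CoxeterMatrix I} {W : Type*} [Group W] (cs : CoxeterSystem M W)

theorem simple_comm_of_eq_two {i j : I} (h : M i j = 2) :
    cs.simple i * cs.simple j = cs.simple j * cs.simple i := by
  have := cs.simple_mul_simple_pow i j
  rw [h, pow_two, mul_eq_one_iff_eq_inv] at this
  simpa using this

theorem simple_mul_wordProd_comm {i : I} {ω : List I} (h : ∀ j ∈ ω, M i j = 2) :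
    cs.simple i * cs.wordProd ω = cs.wordProd ω * cs.simple i := by
  induction ω with
  | nil => simp
  | cons j ω ih =>
    rw [List.forall_mem_cons] at h
    rw [wordProd_cons, ← mul_assoc, cs.simple_comm_of_eq_two h.1, mul_assoc, ih h.2, mul_assoc]

theorem exists_wordProd_eq_simple_mul {i : I} {ω : List I} (h : M.Exposed i ω) :
    ∃ ω' : List I, ω'.length + 1 = ω.length ∧ cs.wordProd ω' = cs.simple i * cs.wordProd ω := by
  induction ω with
  | nil => exact h.elim
  | cons j ω ih =>
    rcases h with rfl | ⟨hij, h⟩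
    · exact ⟨ω, rfl, by simp [wordProd_cons]⟩
    · obtain ⟨ω', hl, hp⟩ := ih h
      refine ⟨j :: ω', by simp [hl], ?_⟩
      rw [wordProd_cons, wordProd_cons, hp, ← mul_assoc, ← mul_assoc, cs.simple_comm_of_eq_two hij]

theorem exists_shorter_of_not_traceReduced {ω : List I} (h : ¬ M.TraceReduced ω) :
    ∃ ω' : List I, ω'.length < ω.length ∧ cs.wordProd ω' = cs.wordProd ω := by
  induction ω with
  | nil => exact (h trivial).elim
  | cons i ω ih =>
    by_cases hω : M.TraceReduced ω
    · have hi : M.Exposed i ω := by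
        by_contra hi
        exact h ⟨hi, hω⟩
      obtain ⟨ω', hl, hp⟩ := cs.exists_wordProd_eq_simple_mul hi
      exact ⟨ω', by simp only [List.length_cons]; omega, by rw [hp, wordProd_cons]⟩
    · obtain ⟨ω', hl, hp⟩ := ih hω
      exact ⟨i :: ω', by simpa using hl, by rw [wordProd_cons, wordProd_cons, hp]⟩

theorem IsReduced.traceReduced {cs : CoxeterSystem M W} {ω : List I} (h : cs.IsReduced ω) :
    M.TraceReduced ω := by
  by_contra hω
  obtain ⟨ω', hl, hp⟩ := cs.exists_shorter_of_not_traceReduced hω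
  have := cs.length_wordProd_le ω'
  rw [hp, h.eq] at this
  omega

/-- If the last letter of `ω ++ [k]` cancels, then it can be moved to the end of `ω`. -/
theorem exists_wordProd_eq_mul_simple {k : I} {ω : List I} (h : M.TraceReduced ω)
    (h' : ¬ M.TraceReduced (ω ++ [k])) :
    ∃ ω' : List I, ω'.length + 1 = ω.length ∧ M.TraceReduced ω' ∧
      cs.wordProd ω = cs.wordProd (ω' ++ [k]) ∧ ∀ i, M.Exposed i ω' → M.Exposed i ω := by
  induction ω with
  | nil => exact (h' ⟨id, trivial⟩).elim
  | cons i ω ih =>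
    by_cases hω : M.TraceReduced (ω ++ [k])
    · have hi : M.Exposed i (ω ++ [k]) := by
        by_contra hi
        exact h' ⟨hi, hω⟩
      obtain hi | ⟨rfl, hc⟩ := exposed_append_singleton.1 hi
      · exact (h.1 hi).elim
      refine ⟨ω, rfl, h.2, ?_, fun j hj => Or.inr ⟨?_, hj⟩⟩
      · rw [wordProd_cons, cs.simple_mul_wordProd_comm hc, wordProd_append, wordProd_singleton]
      · rw [M.symmetric]
        exact hc j hj.mem
    · obtain ⟨ω', hl, hr, hp, he⟩ := ih h.2 hω
      refine ⟨i :: ω', by simp [hl], ⟨fun hi => h.1 (he i hi), hr⟩, ?_, fun j hj => ?_⟩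
      · rw [wordProd_cons, hp, List.cons_append, wordProd_cons]
      · exact hj.imp id fun h => ⟨h.1, he j h.2⟩

variable [Finite I]

/-- Otherwise `ω` and `η` both send the simple root of `k` to a nonnegative vector. These two
vectors are opposite because `η` represents `ω` times the reflection `k`, so both vanish, which is
impossible for an invertible map. -/
theorem not_traceReduced_append_of_wordProd_eq (hM : M.IsRightAngled) {k : I} {ω η : List I}
    (hω : M.TraceReduced (ω ++ [k])) (h : cs.wordProd (ω ++ [k]) = cs.wordProd η) :
    ¬ M.TraceReduced (η ++ [k]) := by
  classical
  have := Fintype.ofFinite I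
  intro hη
  let ρ := cs.lift ⟨_, isLiftable_geomReflection hM⟩
  have hρ : ∀ θ : List I, ρ (cs.wordProd θ) = (θ.map M.geomReflection).prod := by
    intro θ
    rw [wordProd, map_list_prod, List.map_map]
    congr 2
    exact funext fun i => cs.lift_apply_simple _ i
  have h1 := (geomReflection_prod_nonneg hM k ω hω).1
  have h2 := (geomReflection_prod_nonneg hM k η hη).1
  have h3 : M.geomReflection k (Pi.single k 1) = -Pi.single k 1 := by
    have h0 : M.linkSum k (Pi.single k 1) = 0 := by
      rw [linkSum_apply]
      refine Finset.sum_eq_zero fun j _ => ?_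
      split_ifs with h
      · rw [Pi.single_eq_of_ne]
        rintro rfl
        simp at h
      · rfl
    ext i
    by_cases hi : i = k
    · subst hi
      rw [geomReflection_apply_self, h0]
      simp
    · rw [geomReflection_apply_of_ne hi]
      simp [hi]
  rw [← hρ] at h1 h2
  rw [← h, wordProd_append, wordProd_singleton, map_mul, Module.End.mul_apply] at h2
  have h4 : ρ (cs.simple k) (Pi.single k 1) = -Pi.single k 1 := by
    rw [← h3]
    exact congrArg (fun f : Module.End ℤ (I → ℤ) => f (Pi.single k 1)) (cs.lift_apply_simple _ k)
  rw [h4, map_neg] at h2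
  have h5 : ρ (cs.wordProd ω) (Pi.single k 1) = 0 := le_antisymm (neg_nonneg.1 h2) h1
  have h6 : ρ ((cs.wordProd ω)⁻¹ * cs.wordProd ω) (Pi.single k 1) = 0 := by
    rw [map_mul, Module.End.mul_apply, h5, map_zero]
  rw [inv_mul_cancel, map_one] at h6
  simpa using congrFun h6 k

/-- Induction by cancelling the last letter `k` of `ω`: it also cancels against `η`, so commutations
bring an occurrence of `k` to the end of `η`. -/
theorem length_eq_of_traceReduced (hM : M.IsRightAngled) {ω η : List I}
    (hω : M.TraceReduced ω) (hη : M.TraceReduced η)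
    (h : cs.wordProd ω = cs.wordProd η) : ω.length = η.length := by
  induction hn : ω.length generalizing ω η with
  | zero =>
    obtain rfl := List.length_eq_zero_iff.1 hn
    rcases List.eq_nil_or_concat' η with rfl | ⟨η', k, rfl⟩
    · rfl
    · exact (cs.not_traceReduced_append_of_wordProd_eq hM hη h.symm ⟨id, trivial⟩).elim
  | succ n ih =>
    rcases List.eq_nil_or_concat' ω with rfl | ⟨ω', k, rfl⟩
    · simp at hn
    obtain ⟨η', hl, hr, hp, -⟩ := cs.exists_wordProd_eq_mul_simple hη
      (cs.not_traceReduced_append_of_wordProd_eq hM hω h)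
    rw [hp, wordProd_append, wordProd_append] at h
    have := ih hω.of_append hr (mul_right_cancel h) (by simpa using hn)
    omega

theorem isReduced_iff_traceReduced (hM : M.IsRightAngled) {ω : List I} :
    cs.IsReduced ω ↔ M.TraceReduced ω := by
  refine ⟨IsReduced.traceReduced, fun h => ?_⟩
  obtain ⟨η, hη, hp⟩ := cs.exists_isReduced (cs.wordProd ω)
  rw [IsReduced, hp, hη.eq]
  exact (cs.length_eq_of_traceReduced hM h hη.traceReduced hp).symm

/-- For a trace-reduced word, exposure of a letter depends only on the group element. -/
theorem exposed_of_wordProd_eq (hM : M.IsRightAngled) {i : I} {ω η : List I}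
    (hω : M.TraceReduced ω)
    (hη : M.TraceReduced η) (h : cs.wordProd ω = cs.wordProd η) (hi : M.Exposed i ω) :
    M.Exposed i η := by
  by_contra hiη
  have h1 : cs.IsReduced (i :: η) := (cs.isReduced_iff_traceReduced hM).2 ⟨hiη, hη⟩
  obtain ⟨ω', hl, hp⟩ := cs.exists_wordProd_eq_simple_mul hi
  have h2 := cs.length_wordProd_le ω'
  rw [hp, h, ← wordProd_cons, h1.eq, List.length_cons] at h2
  have := cs.length_eq_of_traceReduced hM hω hη h
  omega

end CoxeterSystem

/-! ### Galleries in right-angled buildings -/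

namespace ChamberSystem

variable {I Δ : Type*} {C : ChamberSystem I Δ} {M : CoxeterMatrix I}

variable (C) in
/-- The `i`-panel containing `c`. -/
def panel (i : I) (c : Δ) : Set Δ := {d | (C.adj i) d c}

theorem panel_mem_panels (i : I) (c : Δ) : C.panel i c ∈ C.panels i := ⟨c, rfl⟩

theorem mem_panel {i : I} {c d : Δ} : d ∈ C.panel i c ↔ (C.adj i) c d :=
  ⟨(C.adj i).symm, (C.adj i).symm⟩

theorem isGallery_append {ω η : List I} {c e : Δ} :
    C.IsGallery c (ω ++ η) e ↔ ∃ d, C.IsGallery c ω d ∧ C.IsGallery d η e := by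
  induction ω generalizing c with
  | nil =>
    refine ⟨fun h => ⟨c, .nil c, h⟩, ?_⟩
    rintro ⟨d, h, h'⟩
    cases h
    exact h'
  | cons i ω ih =>
    constructor
    · intro h
      cases h with
      | cons h1 h2 h3 =>
        obtain ⟨d, h4, h5⟩ := ih.1 h3
        exact ⟨d, .cons h1 h2 h4, h5⟩
    · rintro ⟨d, h, h'⟩
      cases h with
      | cons h1 h2 h3 => exact .cons h1 h2 (ih.2 ⟨d, h3, h'⟩)

theorem isGallery_singleton {i : I} {c d : Δ} :
    C.IsGallery c [i] d ↔ (C.adj i) c d ∧ c ≠ d := by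
  constructor
  · intro h
    cases h with
    | cons h1 h2 h3 => cases h3; exact ⟨h1, h2⟩
  · rintro ⟨h1, h2⟩
    exact .cons h1 h2 (.nil d)

theorem IsGallery.map {ω : List I} {c d : Δ} (h : C.IsGallery c ω d) (g : C.aut) :
    C.IsGallery ((g : Equiv.Perm Δ) c) ω ((g : Equiv.Perm Δ) d) := by
  induction h with
  | nil c => exact .nil _
  | cons h1 h2 _ ih => exact .cons ((g.2 _ _ _).2 h1) (fun h => h2 (g.1.injective h)) ih

namespace IsBuilding

variable (hC : C.IsBuilding M)
include hC

theorem exists_isGallery (c d : Δ) : ∃ ω, M.TraceReduced ω ∧ C.IsGallery c ω d := by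
  obtain ⟨δ, hδ⟩ := hC.exists_dist
  obtain ⟨ω, hω, h⟩ := M.toCoxeterSystem.exists_isReduced (δ c d)
  exact ⟨ω, hω.traceReduced, (hδ ω hω c d).1 h⟩

variable [Finite I] (hM : M.IsRightAngled)
include hM

theorem wordProd_eq {c d : Δ} {ω η : List I} (hω : M.TraceReduced ω) (hη : M.TraceReduced η)
    (h : C.IsGallery c ω d) (h' : C.IsGallery c η d) :
    M.toCoxeterSystem.wordProd ω = M.toCoxeterSystem.wordProd η := by
  obtain ⟨δ, hδ⟩ := hC.exists_dist
  rw [← M.toCoxeterSystem.isReduced_iff_traceReduced hM] at hω hη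
  rw [← (hδ ω hω c d).2 h, (hδ η hη c d).2 h']

theorem isGallery_of_wordProd_eq {c d : Δ} {ω η : List I} (hω : M.TraceReduced ω)
    (hη : M.TraceReduced η) (h : C.IsGallery c ω d)
    (h' : M.toCoxeterSystem.wordProd ω = M.toCoxeterSystem.wordProd η) : C.IsGallery c η d := by
  obtain ⟨δ, hδ⟩ := hC.exists_dist
  rw [← M.toCoxeterSystem.isReduced_iff_traceReduced hM] at hω hη
  rw [← hδ η hη, ← h', hδ ω hω]
  exact h

theorem eq_nil_of_isGallery {c : Δ} {ω : List I} (hω : M.TraceReduced ω)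
    (h : C.IsGallery c ω c) : ω = [] :=
  List.length_eq_zero_iff.1 <| M.toCoxeterSystem.length_eq_of_traceReduced hM (η := []) hω trivial
    (hC.wordProd_eq hM hω trivial h (.nil c))

end IsBuilding

end ChamberSystem

/-! ### Coloured words -/

namespace LegalColouring

open ChamberSystem CoxeterMatrix

variable {I Δ : Type*} {C : ChamberSystem I Δ} {X : I → Type*} (l : LegalColouring C X)

/-- The chamber of `i`-colour `x` in the `i`-panel of `c`. -/
noncomputable def move (c : Δ) (i : I) (x : X i) : Δ :=
  (l.panelEquiv (C.panel_mem_panels i c)).symm x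

theorem adj_move (c : Δ) (i : I) (x : X i) : (C.adj i) c (l.move c i x) :=
  mem_panel.1 ((l.panelEquiv (C.panel_mem_panels i c)).symm x).2

@[simp]
theorem colour_move_self (c : Δ) (i : I) (x : X i) : l.colour (l.move c i x) i = x :=
  (l.panelEquiv (C.panel_mem_panels i c)).apply_symm_apply x

theorem colour_eq_of_adj {i j : I} (h : j ≠ i) {c d : Δ} (hcd : (C.adj i) c d) :
    l.colour c j = l.colour d j :=
  l.constant i _ (C.panel_mem_panels i c) j h c (mem_panel.2 ((C.adj i).refl c)) d
    (mem_panel.2 hcd)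

theorem colour_move_of_ne {i j : I} (h : j ≠ i) (c : Δ) (x : X i) :
    l.colour (l.move c i x) j = l.colour c j :=
  (l.colour_eq_of_adj h (l.adj_move c i x)).symm

theorem move_eq_iff {c d : Δ} {i : I} {x : X i} :
    l.move c i x = d ↔ (C.adj i) c d ∧ l.colour d i = x := by
  constructor
  · rintro rfl
    exact ⟨l.adj_move c i x, l.colour_move_self c i x⟩
  · rintro ⟨h, rfl⟩
    exact congrArg Subtype.val
      ((l.panelEquiv (C.panel_mem_panels i c)).symm_apply_apply ⟨d, mem_panel.2 h⟩)

theorem move_colour {c d : Δ} {i : I} (h : (C.adj i) c d) : l.move c i (l.colour d i) = d :=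
  l.move_eq_iff.2 ⟨h, rfl⟩

@[simp]
theorem move_colour_self (c : Δ) (i : I) : l.move c i (l.colour c i) = c :=
  l.move_colour ((C.adj i).refl c)

theorem move_eq_of_adj {c d : Δ} {i : I} (h : (C.adj i) c d) (x : X i) :
    l.move c i x = l.move d i x :=
  l.move_eq_iff.2 ⟨(C.adj i).trans h (l.adj_move d i x), l.colour_move_self d i x⟩

@[simp]
theorem move_move (c : Δ) (i : I) (x y : X i) : l.move (l.move c i x) i y = l.move c i y :=
  (l.move_eq_of_adj (l.adj_move c i x) y).symm

/-- The end of the stuttering gallery from `c` described by a coloured word. -/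
noncomputable def walk (c : Δ) (w : List (Σ i, X i)) : Δ :=
  w.foldl (fun c a => l.move c a.1 a.2) c

@[simp]
theorem walk_cons (c : Δ) (a : Σ i, X i) (w : List (Σ i, X i)) :
    l.walk c (a :: w) = l.walk (l.move c a.1 a.2) w := rfl

theorem walk_append (c : Δ) (w v : List (Σ i, X i)) :
    l.walk c (w ++ v) = l.walk (l.walk c w) v := List.foldl_append

/-- The coloured word obtained by applying a permutation to the colours of each type. -/
def recolour (s : ∀ i, Equiv.Perm (X i)) (w : List (Σ i, X i)) : List (Σ i, X i) :=
  w.map fun a => ⟨a.1, s a.1 a.2⟩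

theorem recolour_append (s : ∀ i, Equiv.Perm (X i)) (w v : List (Σ i, X i)) :
    recolour s (w ++ v) = recolour s w ++ recolour s v := List.map_append

theorem recolour_one (w : List (Σ i, X i)) : recolour (fun i => (1 : Equiv.Perm (X i))) w = w :=
  List.map_id w

theorem recolour_symm_recolour (s : ∀ i, Equiv.Perm (X i)) (w : List (Σ i, X i)) :
    recolour (fun i => (s i).symm) (recolour s w) = w := by
  simp [recolour, Function.comp_def]

/-- The colours of `d` are the images under `s` of those of `c`. -/
def Matches (s : ∀ i, Equiv.Perm (X i)) (c d : Δ) : Prop :=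
  ∀ i, l.colour d i = s i (l.colour c i)

variable {l} in
theorem Matches.move {s : ∀ i, Equiv.Perm (X i)} {c d : Δ} (h : l.Matches s c d) (i : I)
    (x : X i) : l.Matches s (l.move c i x) (l.move d i (s i x)) := by
  intro j
  by_cases hj : j = i
  · subst hj
    rw [colour_move_self, colour_move_self]
  · rw [l.colour_move_of_ne hj, l.colour_move_of_ne hj, h j]

variable {l} in
theorem Matches.walk {s : ∀ i, Equiv.Perm (X i)} {c d : Δ} (h : l.Matches s c d)
    (w : List (Σ i, X i)) : l.Matches s (l.walk c w) (l.walk d (recolour s w)) := by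
  induction w generalizing c d with
  | nil => exact h
  | cons a w ih => exact ih (h.move a.1 a.2)

variable {l} in
theorem Matches.symm {s : ∀ i, Equiv.Perm (X i)} {c d : Δ} (h : l.Matches s c d) :
    l.Matches (fun i => (s i).symm) d c := fun i => by
  rw [h i, Equiv.symm_apply_apply]

/-- Every step of the walk from `c` changes the chamber. -/
def NonStuttering : Δ → List (Σ i, X i) → Prop
  | _, [] => True
  | c, a :: w => l.colour c a.1 ≠ a.2 ∧ NonStuttering (l.move c a.1 a.2) w

variable {l} in
theorem NonStuttering.isGallery {c : Δ} {w : List (Σ i, X i)} (h : l.NonStuttering c w) :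
    C.IsGallery c (w.map Sigma.fst) (l.walk c w) := by
  induction w generalizing c with
  | nil => exact .nil c
  | cons a w ih =>
    refine .cons (l.adj_move c a.1 a.2) (fun hc => h.1 ?_) (ih h.2)
    conv_lhs => rw [hc]
    exact l.colour_move_self _ _ _

theorem exists_walk_of_isGallery {c d : Δ} {ω : List I} (h : C.IsGallery c ω d) :
    ∃ w : List (Σ i, X i), w.map Sigma.fst = ω ∧ l.walk c w = d := by
  induction h with
  | nil c => exact ⟨[], rfl, rfl⟩
  | @cons c d e i ω h1 h2 _ ih =>
    obtain ⟨w, rfl, rfl⟩ := ih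
    exact ⟨⟨i, l.colour d i⟩ :: w, rfl, by rw [walk_cons, l.move_colour h1]⟩

/-! ### Rigidity of coloured words and the automorphisms they define -/

variable {M : CoxeterMatrix I} (hC : C.IsBuilding M) [Finite I] (hM : M.IsRightAngled)
include hC

omit [Finite I] in
theorem exists_walk (c d : Δ) : ∃ w : List (Σ i, X i), l.walk c w = d := by
  obtain ⟨ω, -, h⟩ := hC.exists_isGallery c d
  obtain ⟨w, -, h⟩ := l.exists_walk_of_isGallery h
  exact ⟨w, h⟩

include hM

/-- If neither step stutters, the building axiom turns the gallery of type `ij` into one of type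
`ji` with the same ends. Its middle chamber is forced, since a step of type `i` leaves the
`j`-colour alone. -/
theorem move_comm {i j : I} (h : M i j = 2) (c : Δ) (x : X i) (y : X j) :
    l.move (l.move c i x) j y = l.move (l.move c j y) i x := by
  have hij := ne_of_eq_two h
  by_cases hx : l.colour c i = x
  · subst hx
    rw [move_colour_self, ← l.colour_move_of_ne hij c y, move_colour_self]
  by_cases hy : l.colour c j = y
  · subst hy
    rw [move_colour_self, ← l.colour_move_of_ne hij.symm c x, move_colour_self]
  have hg : C.IsGallery c [i, j] (l.move (l.move c i x) j y) :=
    NonStuttering.isGallery (w := [⟨i, x⟩, ⟨j, y⟩])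
      ⟨hx, by rwa [l.colour_move_of_ne hij.symm], trivial⟩
  have hr : ∀ {i j : I}, i ≠ j → M.TraceReduced [i, j] := fun hij =>
    ⟨by simpa [Exposed] using hij.symm, id, trivial⟩
  have hg' : C.IsGallery c ([j] ++ [i]) (l.move (l.move c i x) j y) :=
    hC.isGallery_of_wordProd_eq hM (hr hij) (hr hij.symm) hg
      (by simpa [CoxeterSystem.wordProd_cons] using M.toCoxeterSystem.simple_comm_of_eq_two h)
  obtain ⟨d, h1, h2⟩ := isGallery_append.1 hg'
  rw [isGallery_singleton] at h1 h2
  have hd : l.move c j y = d := by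
    rw [l.move_eq_iff]
    refine ⟨h1.1, ?_⟩
    rw [l.colour_eq_of_adj hij.symm h2.1, colour_move_self]
  rw [hd]
  refine (l.move_eq_iff.2 ⟨h2.1, ?_⟩).symm
  rw [l.colour_move_of_ne hij, colour_move_self]

theorem walk_move_of_comm {i : I} {w : List (Σ i, X i)} (h : ∀ a ∈ w, M i a.1 = 2) (c : Δ)
    (x : X i) : l.walk (l.move c i x) w = l.move (l.walk c w) i x := by
  induction w generalizing c with
  | nil => rfl
  | cons a w ih =>
    rw [List.forall_mem_cons] at h
    rw [walk_cons, l.move_comm hC hM h.1, ih h.2, walk_cons]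

/-- The initial move commutes past the letters before the exposed `i`, which then overwrites its
colour. -/
theorem walk_move_of_exposed {i : I} {w : List (Σ i, X i)} (h : M.Exposed i (w.map Sigma.fst))
    (c : Δ) (x : X i) : l.walk (l.move c i x) w = l.walk c w := by
  induction w generalizing c with
  | nil => exact h.elim
  | cons a w ih =>
    obtain ⟨j, y⟩ := a
    rcases h with h | ⟨hij, h⟩
    · obtain rfl : j = i := h
      rw [walk_cons, walk_cons, move_move]
    · rw [walk_cons, walk_cons, l.move_comm hC hM hij, ih h]

/-- A coloured word that stutters or is not reduced can be shortened, and this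
is compatible with recolouring. -/
theorem exists_shorter {c : Δ} {w : List (Σ i, X i)}
    (h : ¬ (l.NonStuttering c w ∧ M.TraceReduced (w.map Sigma.fst))) :
    ∃ v : List (Σ i, X i), v.length < w.length ∧ ∀ (s : ∀ i, Equiv.Perm (X i)) (d : Δ),
      l.Matches s c d → l.walk d (recolour s w) = l.walk d (recolour s v) := by
  induction w generalizing c with
  | nil => exact (h ⟨trivial, trivial⟩).elim
  | cons a w ih =>
    obtain ⟨i, x⟩ := a
    by_cases hx : l.colour c i = x
    · refine ⟨w, by simp, fun s d hd => ?_⟩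
      subst hx
      have : l.move d i (s i (l.colour c i)) = d := by rw [← hd i, move_colour_self]
      change l.walk (l.move d i (s i (l.colour c i))) _ = _
      rw [this]
      rfl
    by_cases hw : l.NonStuttering (l.move c i x) w ∧ M.TraceReduced (w.map Sigma.fst)
    · have hi : M.Exposed i (w.map Sigma.fst) := by
        by_contra hi
        exact h ⟨⟨hx, hw.1⟩, hi, hw.2⟩
      refine ⟨w, by simp, fun s d _ => l.walk_move_of_exposed hC hM ?_ d (s i x)⟩
      simpa [recolour, Function.comp_def] using hi
    · obtain ⟨v, hv, hs⟩ := ih hw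
      exact ⟨⟨i, x⟩ :: v, by simpa using hv, fun s d hd => hs s _ (hd.move i x)⟩

/-- Shortening does not affect endpoints before or after recolouring, and a closed gallery of
reduced type is empty. -/
theorem walk_recolour_of_closed {s : ∀ i, Equiv.Perm (X i)} {c d : Δ} (hd : l.Matches s c d)
    {w : List (Σ i, X i)} (h : l.walk c w = c) : l.walk d (recolour s w) = d := by
  induction hn : w.length using Nat.strong_induction_on generalizing w with
  | _ n ih =>
    by_cases hw : l.NonStuttering c w ∧ M.TraceReduced (w.map Sigma.fst)
    · have hg := hw.1.isGallery
      rw [h] at hg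
      rw [List.map_eq_nil_iff.1 (hC.eq_nil_of_isGallery hM hw.2 hg)]
      rfl
    · obtain ⟨v, hv, hs⟩ := l.exists_shorter hC hM hw
      rw [hs s d hd]
      refine ih v.length (hn ▸ hv) ?_ rfl
      -- The trivial recolouring shows that the shortened word is still closed at `c`.
      have := hs (fun i => 1) c fun i => rfl
      rwa [recolour_one, recolour_one, h, eq_comm] at this

/-- With `u` leading from the common end back to `c`, the words `w ++ u` and `u ++ v` are closed at
`c` and at the common end respectively; both stay closed after recolouring, and comparing them gives
the claim. -/
theorem walk_recolour_congr {s : ∀ i, Equiv.Perm (X i)} {c d : Δ} (hd : l.Matches s c d)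
    {w v : List (Σ i, X i)} (h : l.walk c w = l.walk c v) :
    l.walk d (recolour s w) = l.walk d (recolour s v) := by
  obtain ⟨u, hu⟩ := l.exists_walk hC (l.walk c v) c
  have h1 : l.walk d (recolour s (v ++ u)) = d :=
    l.walk_recolour_of_closed hC hM hd (by rw [walk_append, hu])
  have h2 : l.walk (l.walk d (recolour s w)) (recolour s (u ++ v)) = l.walk d (recolour s w) :=
    l.walk_recolour_of_closed hC hM (hd.walk w) (by rw [walk_append, h, hu])
  have h3 : l.walk d (recolour s (w ++ u)) = d :=
    l.walk_recolour_of_closed hC hM hd (by rw [walk_append, h, hu])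
  rw [recolour_append, walk_append] at h1 h2 h3
  rw [← h2, h3]

theorem exists_develop {s : ∀ i, Equiv.Perm (X i)} {c d : Δ} (hd : l.Matches s c d) :
    ∃ φ : Δ → Δ, ∀ w, φ (l.walk c w) = l.walk d (recolour s w) := by
  choose w hw using l.exists_walk hC c
  exact ⟨fun e => l.walk d (recolour s (w e)), fun v => l.walk_recolour_congr hC hM hd (hw _)⟩

/-- Given chambers whose colours are matched by `s`, some automorphism maps the first one to
the second one and acts as `s` on all colours. -/
theorem exists_aut_of_matches {s : ∀ i, Equiv.Perm (X i)} {c d : Δ} (hd : l.Matches s c d) :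
    ∃ g : C.aut, (∀ w, (g : Equiv.Perm Δ) (l.walk c w) = l.walk d (recolour s w)) ∧
      ∀ e, l.Matches s e ((g : Equiv.Perm Δ) e) := by
  obtain ⟨φ, hφ⟩ := l.exists_develop hC hM hd
  obtain ⟨ψ, hψ⟩ := l.exists_develop hC hM hd.symm
  have hs : ∀ w : List (Σ i, X i), recolour s (recolour (fun i => (s i).symm) w) = w :=
    recolour_symm_recolour fun i => (s i).symm
  have h1 : ∀ e, ψ (φ e) = e := fun e => by
    obtain ⟨w, rfl⟩ := l.exists_walk hC c e
    rw [hφ, hψ, recolour_symm_recolour]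
  have h2 : ∀ e, φ (ψ e) = e := fun e => by
    obtain ⟨w, rfl⟩ := l.exists_walk hC d e
    rw [hψ, hφ, hs]
  have h3 : ∀ i {a b : Δ}, (C.adj i) a b → (C.adj i) (φ a) (φ b) := fun i a b hab => by
    obtain ⟨w, rfl⟩ := l.exists_walk hC c a
    rw [← l.move_colour hab]
    have := hφ (w ++ [⟨i, l.colour b i⟩])
    rw [walk_append, recolour_append, walk_append, ← hφ w] at this
    exact this ▸ l.adj_move _ _ _
  have h4 : ∀ i {a b : Δ}, (C.adj i) a b → (C.adj i) (ψ a) (ψ b) := fun i a b hab => by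
    obtain ⟨w, rfl⟩ := l.exists_walk hC d a
    rw [← l.move_colour hab]
    have := hψ (w ++ [⟨i, l.colour b i⟩])
    rw [walk_append, recolour_append, walk_append, ← hψ w] at this
    exact this ▸ l.adj_move _ _ _
  refine ⟨⟨⟨φ, ψ, h1, h2⟩, fun i a b => ⟨fun h => ?_, h3 i⟩⟩, hφ, fun e => ?_⟩
  · have := h4 i h
    simpa only [Equiv.coe_fn_mk, h1] using this
  · obtain ⟨w, rfl⟩ := l.exists_walk hC c e
    change l.Matches s _ (φ _)
    rw [hφ]
    exact hd.walk w

end LegalColouring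

/-! ### Wings -/

namespace LegalColouring

open ChamberSystem CoxeterMatrix

variable {I Δ : Type*} {C : ChamberSystem I Δ} {X : I → Type*} (l : LegalColouring C X)

theorem colour_walk_of_ne {i : I} {w : List (Σ i, X i)} (h : ∀ a ∈ w, a.1 ≠ i) (c : Δ) :
    l.colour (l.walk c w) i = l.colour c i := by
  induction w generalizing c with
  | nil => rfl
  | cons a w ih =>
    rw [List.forall_mem_cons] at h
    rw [walk_cons, ih h.2, l.colour_move_of_ne h.1.symm]

/-- The chambers whose projection to the `i`-panel of `c` is the chamber of colour `x`. -/
def wing (M : CoxeterMatrix I) (c : Δ) (i : I) (x : X i) : Set Δ :=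
  {d | ∃ ω, M.TraceReduced (i :: ω) ∧ C.IsGallery (l.move c i x) ω d}

variable {M : CoxeterMatrix I}

theorem move_mem_wing (c : Δ) (i : I) (x : X i) : l.move c i x ∈ l.wing M c i x :=
  ⟨[], ⟨id, trivial⟩, .nil _⟩

variable {l} in
theorem map_mem_wing {c : Δ} {i : I} {x y : X i} {d : Δ} (g : C.aut)
    (hg : (g : Equiv.Perm Δ) (l.move c i x) = l.move c i y) (hd : d ∈ l.wing M c i x) :
    (g : Equiv.Perm Δ) d ∈ l.wing M c i y := by
  obtain ⟨ω, hω, h⟩ := hd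
  exact ⟨ω, hω, hg ▸ h.map g⟩

variable (hC : C.IsBuilding M) [Finite I] (hM : M.IsRightAngled)
include hC hM

/-- If a reduced gallery type from `c` to `d` exposes `i`, the letter can be moved to the front, and
the first step leads to the projection. Otherwise `c` itself is the projection. -/
theorem exists_mem_wing (c : Δ) (i : I) (d : Δ) : ∃ x, d ∈ l.wing M c i x := by
  obtain ⟨ω, hω, h⟩ := hC.exists_isGallery c d
  by_cases hi : M.Exposed i ω
  · obtain ⟨ω', hl, hp⟩ := M.toCoxeterSystem.exists_wordProd_eq_simple_mul hi
    have hp' : M.toCoxeterSystem.wordProd ω = M.toCoxeterSystem.wordProd (i :: ω') := by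
      rw [CoxeterSystem.wordProd_cons, hp, CoxeterSystem.simple_mul_simple_cancel_left]
    have hω' : M.TraceReduced (i :: ω') := by
      rw [← M.toCoxeterSystem.isReduced_iff_traceReduced hM] at hω ⊢
      rw [CoxeterSystem.IsReduced, ← hp', hω.eq, ← hl, List.length_cons]
    have hg := hC.isGallery_of_wordProd_eq hM hω hω' h hp'
    cases hg with
    | @cons _ q _ _ _ h1 h2 h3 => exact ⟨l.colour q i, ω', hω', by rwa [l.move_colour h1]⟩
  · exact ⟨l.colour c i, ω, ⟨hi, hω⟩, by rwa [move_colour_self]⟩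

variable {l} in
theorem eq_of_mem_wing {c : Δ} {i : I} {x y : X i} {d : Δ} (hx : d ∈ l.wing M c i x)
    (hy : d ∈ l.wing M c i y) : x = y := by
  by_contra hxy
  obtain ⟨ω, hω, h⟩ := hx
  obtain ⟨η, hη, h'⟩ := hy
  have hg : C.IsGallery (l.move c i y) (i :: ω) d := by
    refine .cons ((C.adj i).trans ((C.adj i).symm (l.adj_move c i y)) (l.adj_move c i x))
      (fun he => hxy ?_) h
    rw [← l.colour_move_self c i x, ← he, colour_move_self]
  exact hη.1 (M.toCoxeterSystem.exposed_of_wordProd_eq hM hω hη.2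
    (hC.wordProd_eq hM hω hη.2 hg h') (Or.inl rfl))

variable {l} in
/-- Adjacent chambers lie in a common wing, unless their panel is parallel to that of `c`. -/
theorem mem_wing_of_adj {c : Δ} {i j : I} {x : X i} {d e : Δ} (hd : d ∈ l.wing M c i x)
    (hde : (C.adj j) d e) : e ∈ l.wing M c i x ∨
      (j = i ∧ ∃ w : List (Σ i, X i), (∀ a ∈ w, M i a.1 = 2) ∧ l.walk (l.move c i x) w = d) := by
  by_cases hne : d = e
  · exact Or.inl (hne ▸ hd)
  obtain ⟨ω, ⟨hi, hω⟩, h⟩ := hd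
  have hge : ∀ {ω d}, C.IsGallery (l.move c i x) ω d → (C.adj j) d e → d ≠ e →
      C.IsGallery (l.move c i x) (ω ++ [j]) e := fun h1 h2 h3 =>
    isGallery_append.2 ⟨_, h1, isGallery_singleton.2 ⟨h2, h3⟩⟩
  by_cases hj : M.TraceReduced (ω ++ [j])
  -- Since `i` is not exposed in `ω`, it can only become so through the new last letter: then `j =
  -- i` and all of `ω` commutes with `i`.
  · by_cases hij : M.Exposed i (ω ++ [j])
    · obtain hij | ⟨rfl, hc⟩ := exposed_append_singleton.1 hij
      · exact (hi hij).elim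
      obtain ⟨w, rfl, hw⟩ := l.exists_walk_of_isGallery h
      exact Or.inr ⟨rfl, w, fun a ha => hc _ (List.mem_map_of_mem ha), hw⟩
    · exact Or.inl ⟨ω ++ [j], ⟨hij, hj⟩, hge h hde hne⟩
  · left
    obtain ⟨ω', hl, hr, hp, he⟩ := M.toCoxeterSystem.exists_wordProd_eq_mul_simple hω hj
    have hω' : M.TraceReduced (ω' ++ [j]) := by
      rw [← M.toCoxeterSystem.isReduced_iff_traceReduced hM] at hω ⊢
      rw [CoxeterSystem.IsReduced, ← hp, hω.eq, ← hl, List.length_append, List.length_singleton]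
    -- The `j`-panel of `d` and `e` is entered at `q`. Either `e` is `q`, or a single `j`-step leads
    -- from `q` to `e`.
    obtain ⟨q, h1, h2⟩ := isGallery_append.1 (hC.isGallery_of_wordProd_eq hM hω hω' h hp)
    rw [isGallery_singleton] at h2
    by_cases hq : q = e
    · exact ⟨ω', ⟨fun h => hi (he i h), hr⟩, hq ▸ h1⟩
    · exact ⟨ω' ++ [j],
        ⟨fun h => hi (M.toCoxeterSystem.exposed_of_wordProd_eq hM hω' hω hp.symm h), hω'⟩,
        hge h1 ((C.adj j).trans h2.1 hde) hq⟩

variable {l} in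
theorem walk_mem_wing {c : Δ} {i : I} {x : X i} {w : List (Σ i, X i)} (h : ∀ a ∈ w, a.1 ≠ i)
    {d : Δ} (hd : d ∈ l.wing M c i x) : l.walk d w ∈ l.wing M c i x := by
  induction w generalizing d with
  | nil => exact hd
  | cons a w ih =>
    rw [List.forall_mem_cons] at h
    refine ih h.2 ((mem_wing_of_adj hC hM hd (l.adj_move d a.1 a.2)).resolve_right ?_)
    exact fun h' => h.1 h'.1

omit hC hM [Finite I]

/-! ### Automorphisms supported on wings -/

variable (F : ∀ i, Subgroup (Equiv.Perm (X i)))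

variable {l F} in
theorem mem_universalGroup_of_matches {s : ∀ i, Equiv.Perm (X i)} (hs : ∀ i, s i ∈ F i)
    {g : C.aut} (hg : ∀ e, l.Matches s e ((g : Equiv.Perm Δ) e)) : g ∈ l.universalGroup F := by
  intro i P hP
  rw [l.localAction_eq g hP fun e _ => (hg e i).symm]
  exact hs i

variable {l F} in
theorem exists_local_action (g : l.universalGroup F) (i : I) (c : Δ) :
    ∃ f : F i, ∀ d, (C.adj i) c d → l.colour (g • d) i = f • l.colour d i :=
  ⟨⟨_, g.2 i _ (C.panel_mem_panels i c)⟩, fun _ hd =>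
    (l.localAction_colour (g : C.aut) _ (mem_panel.2 hd)).symm⟩

variable {l F} in
theorem adj_smul (g : l.universalGroup F) {i : I} {c d : Δ} (h : (C.adj i) c d) :
    (C.adj i) (g • c) (g • d) := ((g : C.aut).2 i c d).2 h

variable [Finite I]
include hC hM

/-- A system of elements of the universal group that transport the chambers of the `i`-panel of
`c` to each other and preserve all colours other than `i`. -/
theorem exists_transport (c : Δ) (i : I) :
    ∃ Θ : X i → X i → l.universalGroup F, (∀ x, Θ x x = 1) ∧
      (∀ x y z, Θ y z * Θ x y = Θ x z) ∧
      ∀ (f : F i) (x : X i) (w : List (Σ i, X i)), (∀ a ∈ w, a.1 ≠ i) →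
        Θ x (f • x) • l.walk (l.move c i x) w = l.walk (l.move c i (f • x)) w := by
  classical
  -- Each colour is compared with a fixed representative of its orbit; this makes the transport from
  -- `x` to `y` depend on `x` and `y` alone, with the cocycle identity automatic.
  let rep : X i → X i := fun x => (Quotient.mk (MulAction.orbitRel (F i) (X i)) x).out
  have hR : ∀ x, ∃ g : l.universalGroup F, ∀ w : List (Σ i, X i), (∀ a ∈ w, a.1 ≠ i) →
      g • l.walk (l.move c i (rep x)) w = l.walk (l.move c i x) w := by
    intro x
    obtain ⟨f, hf⟩ : x ∈ MulAction.orbit (F i) (rep x) :=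
      (MulAction.orbitRel (F i) (X i)).symm (Quotient.mk_out (s := MulAction.orbitRel _ _) x)
    -- Acting trivially on colours other than `i` makes the resulting automorphism respect walks
    -- that avoid `i`.
    let s : ∀ j, Equiv.Perm (X j) := Function.update (fun _ => 1) i (f : Equiv.Perm (X i))
    have hsi : s i = f := Function.update_self ..
    have hsj : ∀ j, j ≠ i → s j = 1 := fun j hj => Function.update_of_ne hj ..
    have hm : l.Matches s (l.move c i (rep x)) (l.move c i x) := by
      intro j
      by_cases hj : j = i
      · subst hj
        rw [colour_move_self, colour_move_self, hsi]
        exact hf.symm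
      · rw [l.colour_move_of_ne hj, l.colour_move_of_ne hj, hsj j hj, Equiv.Perm.one_apply]
    obtain ⟨g, h1, h2⟩ := l.exists_aut_of_matches hC hM hm
    refine ⟨⟨g, mem_universalGroup_of_matches (fun j => ?_) h2⟩, fun w hw => ?_⟩
    · by_cases hj : j = i
      · subst hj
        rw [hsi]
        exact f.2
      · rw [hsj j hj]
        exact one_mem _
    · refine (h1 w).trans ?_
      congr 1
      conv_rhs => rw [← List.map_id w]
      refine List.map_congr_left fun a ha => ?_
      rw [hsj _ (hw a ha)]
      rfl
  choose R hR using hR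
  refine ⟨fun x y => R y * (R x)⁻¹, fun x => mul_inv_cancel _, fun x y z => by group,
    fun f x w hw => ?_⟩
  have hrep : rep (f • x) = rep x :=
    congrArg Quotient.out (Quotient.sound (s := MulAction.orbitRel (F i) (X i)) ⟨f, rfl⟩)
  rw [mul_smul, ← hR x w hw, inv_smul_smul, ← hrep, hR _ w hw]

/-- The local group `F i` acts on the building through the universal group, extending its action
on the `i`-panel of `c`, such that the wings of fixed colours are fixed pointwise. -/
theorem exists_wingHom (c : Δ) (i : I) :
    ∃ L : F i →* l.universalGroup F, (∀ f x, L f • l.move c i x = l.move c i (f • x)) ∧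
      ∀ f x, f • x = x → ∀ d ∈ l.wing M c i x, L f • d = d := by
  obtain ⟨Θ, h1, hmul, hw⟩ := l.exists_transport hC hM F c i
  choose κ hκ using l.exists_mem_wing hC hM c i
  have hκ' : ∀ {d x}, d ∈ l.wing M c i x → κ d = x := fun hd => eq_of_mem_wing hC hM (hκ _) hd
  have hmove : ∀ (f : F i) x, Θ x (f • x) • l.move c i x = l.move c i (f • x) := fun f x =>
    hw f x [] (by simp)
  have hmap : ∀ (f : F i) (d : Δ), κ (Θ (κ d) (f • κ d) • d) = f • κ d := fun f d =>
    hκ' (map_mem_wing _ (hmove f (κ d)) (hκ d))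
  -- The action is defined wing by wing, and the cocycle identity makes it multiplicative.
  let act : MulAction (F i) Δ :=
    { smul := fun f d => Θ (κ d) (f • κ d) • d
      one_smul := fun d => by
        change Θ (κ d) ((1 : F i) • κ d) • d = d
        rw [one_smul, h1, one_smul]
      mul_smul := fun f h d => by
        change Θ (κ d) ((f * h) • κ d) • d = Θ (κ (Θ (κ d) (h • κ d) • d))
          (f • κ (Θ (κ d) (h • κ d) • d)) • Θ (κ d) (h • κ d) • d
        rw [hmap, ← mul_smul, hmul, mul_smul] }
  let L₀ : F i →* Equiv.Perm Δ := MulAction.toPermHom (F i) Δ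
  have hL₀ : ∀ f {d x}, d ∈ l.wing M c i x → L₀ f d = Θ x (f • x) • d := fun f d x hd => by
    obtain rfl := hκ' hd
    rfl
  have hne : ∀ {w : List (Σ i, X i)}, (∀ a ∈ w, M i a.1 = 2) → ∀ a ∈ w, a.1 ≠ i :=
    fun hc a ha => (ne_of_eq_two (hc a ha)).symm
  have hpar : ∀ f {x} {w : List (Σ i, X i)}, (∀ a ∈ w, M i a.1 = 2) →
      ∀ e, (C.adj i) (l.walk (l.move c i x) w) e →
        L₀ f e = l.walk (l.move c i (f • l.colour e i)) w := fun f x w hc e he => by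
    have : e = l.walk (l.move c i (l.colour e i)) w := by
      conv_lhs => rw [← l.move_colour he, ← l.walk_move_of_comm hC hM hc, move_move]
    have he' : e ∈ l.wing M c i (l.colour e i) := by
      have h := walk_mem_wing hC hM (hne hc) (l.move_mem_wing (M := M) c i (l.colour e i))
      rwa [← this] at h
    rw [hL₀ f he', ← hw f _ w (hne hc), ← this]
  have hadj : ∀ f j {d e : Δ}, (C.adj j) d e → (C.adj j) (L₀ f d) (L₀ f e) := by
    intro f j d e hde
    -- Inside one wing, `L₀ f` agrees with a single automorphism. Only panels parallel to that of
    -- `c` cross wings, and there `hpar` gives an explicit formula.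
    obtain he | ⟨rfl, w, hc, hd⟩ := mem_wing_of_adj hC hM (hκ d) hde
    · rw [hL₀ f (hκ d), hL₀ f he]
      exact adj_smul _ hde
    · rw [← hd] at hde ⊢
      rw [hpar f hc _ hde, hpar f hc _ ((C.adj _).refl _)]
      generalize f • l.colour e j = z, f • l.colour (l.walk (l.move c j (κ d)) w) j = y
      rw [← l.move_move c j y z, l.walk_move_of_comm hC hM hc (l.move c j y) z]
      exact l.adj_move _ _ _
  have haut : ∀ f, L₀ f ∈ C.aut := fun f j d e => by
    refine ⟨fun h => ?_, hadj f j⟩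
    simpa using hadj f⁻¹ j h
  let L₁ : F i →* C.aut := L₀.codRestrict C.aut haut
  have huniv : ∀ f, L₁ f ∈ l.universalGroup F := by
    intro f j P hP
    obtain ⟨d, hd⟩ := id hP
    have hPd : ∀ e ∈ P, (C.adj j) d e := fun e he => by
      rw [hd] at he
      exact (C.adj j).symm he
    -- On panels parallel to that of `c` the local action is `f` itself; any other panel lies in one
    -- wing and inherits the local action of a transport element.
    by_cases hp : j = i ∧
        ∃ w : List (Σ i, X i), (∀ a ∈ w, M i a.1 = 2) ∧ l.walk (l.move c i (κ d)) w = d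
    · obtain ⟨rfl, w, hc, hw'⟩ := hp
      rw [l.localAction_eq (L₁ f) hP (f := (f : Equiv.Perm (X j)))]
      · exact f.2
      · intro e he
        change _ = l.colour (L₀ f e) j
        rw [hpar f hc e (hw' ▸ hPd e he), l.colour_walk_of_ne (hne hc), colour_move_self]
        rfl
    · rw [l.localAction_eq (L₁ f) hP (f := l.localAction (Θ (κ d) (f • κ d) : C.aut) hP)]
      · exact (Θ (κ d) (f • κ d)).2 j _ _
      · intro e he
        change _ = l.colour (L₀ f e) j
        rw [l.localAction_colour _ _ he,
          hL₀ f ((mem_wing_of_adj hC hM (hκ d) (hPd e he)).resolve_right hp)]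
        rfl
  refine ⟨L₁.codRestrict _ huniv, fun f x => ?_, fun f x hx d hd => ?_⟩
  · change L₀ f (l.move c i x) = _
    rw [hL₀ f (l.move_mem_wing c i x), hmove]
  · change L₀ f d = _
    rw [hL₀ f hd, hx, h1, one_smul]

variable {l F} in
/-- An element of the universal group that fixes `c` and `d` acts on the `i`-panel of `c` by a
permutation that fixes the projection of `d`. -/
theorem local_action_smul_eq {c d : Δ} {i : I} {x : X i} {g : l.universalGroup F} {f : F i}
    (hf : ∀ d, (C.adj i) c d → l.colour (g • d) i = f • l.colour d i) (hc : g • c = c)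
    (hgd : g • d = d) (hd : d ∈ l.wing M c i x) : f • x = x := by
  have hx : g • l.move c i x = l.move c i (f • x) := by
    have h := adj_smul g (l.adj_move c i x)
    rw [hc] at h
    rw [← l.move_colour h, hf _ (l.adj_move c i x), colour_move_self]
  have := map_mem_wing (g : C.aut) hx hd
  change g • d ∈ _ at this
  rw [hgd] at this
  exact eq_of_mem_wing hC hM this hd

end LegalColouring

/-! ### Finite generation over a subgroup -/

/-- `K` is contained in a subgroup generated by `H` and finitely many elements. -/
def Subgroup.FiniteOver {G : Type*} [Group G] (H K : Subgroup G) : Prop :=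
  ∃ A : Set G, A.Finite ∧ K ≤ H ⊔ Subgroup.closure A

namespace Subgroup.FiniteOver

variable {G : Type*} [Group G] {H K K' : Subgroup G}

theorem of_le (h : K ≤ H) : H.FiniteOver K := ⟨∅, Set.finite_empty, h.trans le_sup_left⟩

theorem closure {A : Set G} (hA : A.Finite) : H.FiniteOver (Subgroup.closure A) :=
  ⟨A, hA, le_sup_right⟩

theorem mono (h : H.FiniteOver K) (hK : K' ≤ K) : H.FiniteOver K' := by
  obtain ⟨A, hA, h⟩ := h
  exact ⟨A, hA, hK.trans h⟩

theorem iSup {ι : Type*} [Finite ι] {K : ι → Subgroup G} (h : ∀ i, H.FiniteOver (K i)) :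
    H.FiniteOver (⨆ i, K i) := by
  choose A hA hK using h
  exact ⟨⋃ i, A i, Set.finite_iUnion hA, iSup_le fun i => (hK i).trans
    (sup_le_sup_left (Subgroup.closure_mono (Set.subset_iUnion A i)) H)⟩

theorem sup (h : H.FiniteOver K) (h' : H.FiniteOver K') : H.FiniteOver (K ⊔ K') := by
  obtain ⟨A, hA, h⟩ := h
  obtain ⟨B, hB, h'⟩ := h'
  exact ⟨A ∪ B, hA.union hB, sup_le
    (h.trans (sup_le_sup_left (Subgroup.closure_mono Set.subset_union_left) H))
    (h'.trans (sup_le_sup_left (Subgroup.closure_mono Set.subset_union_right) H))⟩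

end Subgroup.FiniteOver

/-! ### Compactness in the permutation topology -/

section PermTopology

variable {Y : Type*}

theorem isOpen_setOf_perm_eqOn (Φ : Finset Y) (g₀ : Equiv.Perm Y) :
    IsOpen {g : Equiv.Perm Y | ∀ y ∈ Φ, g y = g₀ y} := by
  intro g hg
  refine ⟨Φ, fun s hs y hy => ?_⟩
  have : s y = y := (mem_fixingSubgroup_iff _).1 hs y hy
  rw [Equiv.Perm.mul_apply, this]
  exact hg y hy

theorem isClosed_setOf_perm_fix (Φ : Set Y) :
    IsClosed {g : Equiv.Perm Y | ∀ y ∈ Φ, g y = y} := by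
  refine ⟨fun g hg => ?_⟩
  obtain ⟨y, hy, hgy⟩ : ∃ y ∈ Φ, g y ≠ y := by simpa using hg
  refine ⟨{y}, fun s hs h => hgy ?_⟩
  have : s y = y := (mem_fixingSubgroup_iff _).1 hs y (by simp)
  simpa [this] using h y hy

/-- A compactly generated permutation group is finitely generated over the pointwise stabiliser
of any finite set. -/
theorem IsCompactlyGeneratedGroup.finiteOver {F : Subgroup (Equiv.Perm Y)}
    (hF : IsCompactlyGeneratedGroup F) (Φ : Finset Y) :
    (fixingSubgroup F (Φ : Set Y)).FiniteOver ⊤ := by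
  obtain ⟨S, hS, hgen⟩ := hF
  -- The compact generating set is covered by finitely many left cosets of the open stabiliser of
  -- `Φ`.
  obtain ⟨A, -, hA⟩ := hS.elim_nhds_subcover
    (fun g₀ : F => {g : F | ∀ y ∈ Φ, (g : Equiv.Perm Y) y = (g₀ : Equiv.Perm Y) y})
    fun g₀ _ => ((isOpen_setOf_perm_eqOn Φ (g₀ : Equiv.Perm Y)).preimage
      continuous_subtype_val).mem_nhds fun _ _ => rfl
  refine ⟨A, A.finite_toSet, ?_⟩
  rw [← hgen, Subgroup.closure_le]
  intro g hg
  obtain ⟨a, ha, hga⟩ := Set.mem_iUnion₂.1 (hA hg)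
  rw [← mul_inv_cancel_left a g]
  refine mul_mem (Subgroup.mem_sup_right (Subgroup.subset_closure ha)) (Subgroup.mem_sup_left ?_)
  refine (mem_fixingSubgroup_iff _).2 fun y hy => ?_
  rw [mul_smul, inv_smul_eq_iff]
  exact hga y hy

end PermTopology

/-! ### Generating the universal group over the stabiliser of a finite set -/

namespace LegalColouring

open ChamberSystem CoxeterMatrix

variable {I Δ : Type*} {C : ChamberSystem I Δ} {X : I → Type*} (l : LegalColouring C X)
  (F : ∀ i, Subgroup (Equiv.Perm (X i)))

/-- A compact neighbourhood of the identity contains the stabiliser of some finite set, and such a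
stabiliser is closed. -/
theorem exists_isCompact_fixingSubgroup (hlc : LocallyCompactSpace (l.universalGroup F)) :
    ∃ Φ : Finset Δ, IsCompact (fixingSubgroup (l.universalGroup F) (Φ : Set Δ) :
      Set (l.universalGroup F)) := by
  obtain ⟨K, hK, hK1⟩ := exists_compact_mem_nhds (1 : l.universalGroup F)
  obtain ⟨V, hVK, hV, h1⟩ := mem_nhds_iff.1 hK1
  obtain ⟨V', hV', rfl⟩ := isOpen_induced_iff.1 hV
  obtain ⟨V'', hV'', rfl⟩ := isOpen_induced_iff.1 hV'
  obtain ⟨Φ, hΦ⟩ := hV'' 1 h1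
  refine ⟨Φ, hK.of_isClosed_subset ?_ fun g hg => hVK ?_⟩
  · have := ((isClosed_setOf_perm_fix (Φ : Set Δ)).preimage
      (continuous_subtype_val (p := (· ∈ C.aut)))).preimage
      (continuous_subtype_val (p := (· ∈ l.universalGroup F)))
    convert this using 1
    ext g
    exact mem_fixingSubgroup_iff _
  · have h := hΦ ((g : C.aut) : Equiv.Perm Δ) ((mem_fixingSubgroup_iff _).2 fun y hy =>
      (mem_fixingSubgroup_iff _).1 hg y hy)
    rwa [one_mul] at h

variable {M : CoxeterMatrix I} (hC : C.IsBuilding M) [Finite I] (hM : M.IsRightAngled)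
include hC hM

/-- Chambers whose colours lie in the same orbits of the local groups lie in the same orbit of the
universal group. -/
theorem exists_smul_eq {c d : Δ} (h : ∀ i, ∃ f : F i, l.colour d i = f • l.colour c i) :
    ∃ g : l.universalGroup F, g • c = d := by
  choose f hf using h
  have hm : l.Matches (fun i => (f i : Equiv.Perm (X i))) c d := hf
  obtain ⟨g, h1, h2⟩ := l.exists_aut_of_matches hC hM hm
  exact ⟨⟨g, mem_universalGroup_of_matches (fun i => (f i).2) h2⟩, h1 []⟩

theorem finite_orbits (horb : ∀ i, Finite (MulAction.orbitRel.Quotient (F i) (X i))) :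
    Finite (MulAction.orbitRel.Quotient (l.universalGroup F) Δ) := by
  refine Finite.of_injective (β := ∀ i, MulAction.orbitRel.Quotient (F i) (X i))
    (fun q i => Quotient.mk _ (l.colour q.out i)) fun q q' h => ?_
  obtain ⟨g, hg⟩ := l.exists_smul_eq F hC hM (c := q'.out) (d := q.out) fun i => by
    obtain ⟨f, hf⟩ := Quotient.exact (congrFun h i)
    exact ⟨f, hf.symm⟩
  rw [← Quotient.out_eq q, ← Quotient.out_eq q']
  exact Quotient.sound ⟨g, hg⟩

variable (hgen : ∀ i, IsCompactlyGeneratedGroup (F i)) (Φ : Finset Δ)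
include hgen

theorem exists_wingHom_finiteOver (c : Δ) (i : I) :
    ∃ L : F i →* l.universalGroup F, (∀ f x, L f • l.move c i x = l.move c i (f • x)) ∧
      (∀ f x, f • x = x → ∀ d ∈ l.wing M c i x, L f • d = d) ∧
      (fixingSubgroup (l.universalGroup F) (Φ : Set Δ)).FiniteOver L.range := by
  classical
  obtain ⟨L, h1, h2⟩ := l.exists_wingHom hC hM F c i
  refine ⟨L, h1, h2, ?_⟩
  choose κ hκ using l.exists_mem_wing hC hM c i
  -- An element of `F i` fixing the colours of the projections of `Φ` is sent by `L` into the
  -- stabiliser of `Φ`.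
  obtain ⟨A, hA, htop⟩ := (hgen i).finiteOver (Φ.image κ)
  refine ⟨L '' A, hA.image L, ?_⟩
  rw [MonoidHom.range_eq_map, ← MonoidHom.map_closure]
  refine (Subgroup.map_mono htop).trans ?_
  rw [Subgroup.map_sup]
  refine sup_le_sup_right (Subgroup.map_le_iff_le_comap.2 fun f hf => ?_) _
  refine (mem_fixingSubgroup_iff _).2 fun d hd => h2 f (κ d) ?_ d (hκ d)
  exact (mem_fixingSubgroup_iff _).1 hf _ (by simpa using ⟨d, hd, rfl⟩)

/-- If `g` fixes `Ψ` and acts on the `i`-panel of `c` as `f`, then `L f` agrees with `g` on that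
panel. It also fixes `Ψ`, because `f` fixes the colours of the projections of `Ψ`. So `(L f)⁻¹ * g`
fixes `Ψ` and `d`. -/
theorem finiteOver_fixingSubgroup_of_adj {Ψ : Set Δ} {c d : Δ} {i : I} (hc : c ∈ Ψ)
    (hcd : (C.adj i) c d)
    (h : (fixingSubgroup (l.universalGroup F) (Φ : Set Δ)).FiniteOver
      (fixingSubgroup (l.universalGroup F) (insert d Ψ))) :
    (fixingSubgroup (l.universalGroup F) (Φ : Set Δ)).FiniteOver
      (fixingSubgroup (l.universalGroup F) Ψ) := by
  obtain ⟨L, h1, h2, hL⟩ := l.exists_wingHom_finiteOver F hC hM hgen Φ c i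
  refine (hL.sup h).mono fun g hg => ?_
  rw [mem_fixingSubgroup_iff] at hg
  obtain ⟨f, hf⟩ := exists_local_action g i c
  rw [← mul_inv_cancel_left (L f) g]
  refine mul_mem (Subgroup.mem_sup_left ⟨f, rfl⟩) (Subgroup.mem_sup_right ?_)
  rw [mem_fixingSubgroup_iff]
  rintro e (rfl | he)
  · rw [mul_smul, inv_smul_eq_iff]
    have hge := adj_smul g hcd
    rw [hg c hc] at hge
    rw [← l.move_colour hge, hf _ hcd, ← h1, l.move_colour hcd]
  · obtain ⟨x, hx⟩ := l.exists_mem_wing hC hM c i e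
    rw [mul_smul, hg e he, inv_smul_eq_iff,
      h2 f x (local_action_smul_eq hC hM hf (hg c hc) (hg e he) hx) e hx]

theorem finiteOver_fixingSubgroup_of_isGallery {Ψ : Set Δ} {c d : Δ} {ω : List I}
    (hω : C.IsGallery c ω d) (hc : c ∈ Ψ)
    (h : (fixingSubgroup (l.universalGroup F) (Φ : Set Δ)).FiniteOver
      (fixingSubgroup (l.universalGroup F) (insert d Ψ))) :
    (fixingSubgroup (l.universalGroup F) (Φ : Set Δ)).FiniteOver
      (fixingSubgroup (l.universalGroup F) Ψ) := by
  induction hω generalizing Ψ with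
  | nil c => rwa [Set.insert_eq_of_mem hc] at h
  | cons h1 _ _ ih =>
    refine l.finiteOver_fixingSubgroup_of_adj F hC hM hgen Φ hc h1
      (ih (Set.mem_insert _ _) (h.mono ?_))
    exact fixingSubgroup_antitone _ _ (Set.insert_subset_insert (Set.subset_insert _ _))

/-- Stabilisers of chambers are finitely generated over pointwise stabilisers of finite sets. -/
theorem finiteOver_fixingSubgroup_singleton (c : Δ) :
    (fixingSubgroup (l.universalGroup F) (Φ : Set Δ)).FiniteOver
      (fixingSubgroup (l.universalGroup F) ({c} : Set Δ)) := by
  classical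
  have key : ∀ Ψ : Finset Δ, (fixingSubgroup (l.universalGroup F) (Φ : Set Δ)).FiniteOver
      (fixingSubgroup (l.universalGroup F) (Ψ ∪ {c} : Set Δ)) →
      (fixingSubgroup (l.universalGroup F) (Φ : Set Δ)).FiniteOver
      (fixingSubgroup (l.universalGroup F) ({c} : Set Δ)) := by
    intro Ψ
    induction Ψ using Finset.induction_on with
    | empty =>
      intro h
      rwa [Finset.coe_empty, Set.empty_union] at h
    | insert d Ψ _ ih =>
      intro h
      obtain ⟨ω, -, hω⟩ := hC.exists_isGallery c d
      rw [Finset.coe_insert, Set.insert_union] at h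
      exact ih (l.finiteOver_fixingSubgroup_of_isGallery F hC hM hgen Φ hω (Or.inr rfl) h)
  -- Removing the chambers of `Φ` one at a time from `Φ ∪ {c}` starts at a subgroup of the
  -- stabiliser of `Φ`.
  exact key Φ (.of_le (fixingSubgroup_antitone _ _ Set.subset_union_left))

/-- The universal group is finitely generated over the pointwise stabiliser of any finite set of
chambers. -/
theorem finiteOver_top (horb : ∀ i, Finite (MulAction.orbitRel.Quotient (F i) (X i))) :
    (fixingSubgroup (l.universalGroup F) (Φ : Set Δ)).FiniteOver ⊤ := by
  have := l.finite_orbits F hC hM horb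
  let Q := MulAction.orbitRel.Quotient (l.universalGroup F) Δ
  let O := Σ i, MulAction.orbitRel.Quotient (F i) (X i)
  have hout : ∀ d : Δ, ∃ (q : Q) (g : l.universalGroup F), g • d = q.out := fun d =>
    ⟨Quotient.mk _ d, Quotient.mk_out (s := MulAction.orbitRel _ _) d⟩
  choose L h1 _ hL using l.exists_wingHom_finiteOver F hC hM hgen Φ
  choose rep τ hτ using hout
  let K₁ : Subgroup (l.universalGroup F) :=
    ⨆ q : Q, fixingSubgroup (l.universalGroup F) ({q.out} : Set Δ)
  let K₂ : Subgroup (l.universalGroup F) := ⨆ p : Q × I, (L p.1.out p.2).range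
  let A : Set (l.universalGroup F) :=
    Set.range fun p : Q × O => τ (l.move p.1.out p.2.1 p.2.2.out)
  let K := K₁ ⊔ K₂ ⊔ Subgroup.closure A
  have hK : (fixingSubgroup (l.universalGroup F) (Φ : Set Δ)).FiniteOver K :=
    ((Subgroup.FiniteOver.iSup fun q =>
      l.finiteOver_fixingSubgroup_singleton F hC hM hgen Φ _).sup
      (Subgroup.FiniteOver.iSup fun _ => hL _ _)).sup (.closure (Set.finite_range _))
  have hK₁ : ∀ (q : Q) g, g • q.out = q.out → g ∈ K := fun q g hg => by
    refine Subgroup.mem_sup_left (Subgroup.mem_sup_left (Subgroup.mem_iSup_of_mem q ?_))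
    rw [mem_fixingSubgroup_iff]
    rintro _ rfl
    exact hg
  have hK₂ : ∀ (q : Q) i f, L q.out i f ∈ K := fun q i f =>
    Subgroup.mem_sup_left (Subgroup.mem_sup_right (Subgroup.mem_iSup_of_mem (q, i) ⟨f, rfl⟩))
  have hK₃ : ∀ (q : Q) (o : O), τ (l.move q.out o.1 o.2.out) ∈ K := fun q o =>
    Subgroup.mem_sup_right (Subgroup.subset_closure ⟨(q, o), rfl⟩)
  -- `L` first brings the colour of the neighbour to its orbit representative, leaving finitely many
  -- chambers for the elements `τ` to handle.
  have hadj : ∀ (q : Q) i d, (C.adj i) q.out d → ∃ k ∈ K, ∃ q' : Q, k • d = q'.out := by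
    intro q i d hd
    let o : MulAction.orbitRel.Quotient (F i) (X i) := Quotient.mk _ (l.colour d i)
    obtain ⟨f, hf⟩ : o.out ∈ MulAction.orbit (F i) (l.colour d i) :=
      Quotient.mk_out (s := MulAction.orbitRel _ _) _
    have hmove : L q.out i f • d = l.move q.out i o.out := by
      rw [← hf, ← h1, l.move_colour hd]
    refine ⟨_, mul_mem (hK₃ q ⟨i, o⟩) (hK₂ q i f), rep (l.move q.out i o.out), ?_⟩
    rw [mul_smul, hmove, hτ]
  have hgal : ∀ {c d : Δ} {ω : List I}, C.IsGallery c ω d →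
      (∃ k ∈ K, ∃ q : Q, k • c = q.out) → ∃ k ∈ K, ∃ q : Q, k • d = q.out := by
    intro c d ω h
    induction h with
    | nil c => exact id
    | cons hcd _ _ ih =>
      rintro ⟨k, hk, q, hq⟩
      have := adj_smul k hcd
      rw [hq] at this
      obtain ⟨k', hk', q', hq'⟩ := hadj q _ _ this
      exact ih ⟨k' * k, mul_mem hk' hk, q', by rw [mul_smul, hq']⟩
  refine hK.mono fun g _ => ?_
  obtain ⟨c⟩ := hC.nonempty
  let q₀ : Q := Quotient.mk _ c
  obtain ⟨ω, -, hω⟩ := hC.exists_isGallery q₀.out (g • q₀.out)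
  obtain ⟨k, hk, q, hq⟩ := hgal hω ⟨1, one_mem _, q₀, one_smul _ _⟩
  -- Distinct representatives lie in distinct `U(F)`-orbits, so `k * g` stabilises the base chamber.
  have hqq : q = q₀ := by
    rw [← Quotient.out_eq q, ← Quotient.out_eq q₀]
    exact Quotient.sound ⟨k * g, (mul_smul _ _ _).trans hq⟩
  rw [← inv_mul_cancel_left k g]
  exact mul_mem (inv_mem hk) (hK₁ q₀ _ (by rw [mul_smul, hq, hqq]))

end LegalColouring

theorem mainTheorem4 {I : Type*} [Finite I] (M : CoxeterMatrix I) (hM : M.IsRightAngled)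
    {Δ : Type*} (C : ChamberSystem I Δ) (hC : C.IsBuilding M)
    {X : I → Type*} (l : LegalColouring C X) (F : ∀ i, Subgroup (Equiv.Perm (X i)))
    (hclosed : IsClosed (l.universalGroup F : Set C.aut))
    (hlc : LocallyCompactSpace (l.universalGroup F))
    (hgen : ∀ i, IsCompactlyGeneratedGroup (F i))
    (horb : ∀ i, Finite (MulAction.orbitRel.Quotient (F i) (X i))) :
    IsCompactlyGeneratedGroup (l.universalGroup F) := by
  obtain ⟨Φ, hΦ⟩ := l.exists_isCompact_fixingSubgroup F hlc
  obtain ⟨A, hA, h⟩ := l.finiteOver_top F hC hM hgen Φ horb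
  refine ⟨_, hΦ.union hA.isCompact, ?_⟩
  rw [Subgroup.closure_union, Subgroup.closure_eq]
  exact top_le_iff.1 h
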